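/- Let $q$ be a prime power, let $\alpha,\beta,a,b,c,d\in\mathbb F_{q^2}$ with $d\notin\mathbb F_q$, and suppose that $\alpha=-\beta^q\neq 0$. A rational function over $\mathbb F_{q^2}$ is called a permutation rational function of $\mathbb F_{q^2}$ if the map it induces on $\mathbb F_{q^2}\cup\{\infty\}$ in the usual way (with poles mapped to $\infty$) is a bijection. Then \[\frac{\alpha x^{2q}+\beta x^2+ax^q+bx+c}{x^q+x+d}\] is a permutation rational function of $\mathbb F_{q^2}$ if and only if $q=3$, $a^q+b\notin\mathbb F_q$, $\beta^2=(b^2-a^2-\beta c)^2=1$ and $\beta(a-b)-d=0$. The same conditions are necessary and sufficient for $x\mapsto\frac{\alpha x^{2q}+\beta x^2+ax^q+bx+c}{x^q+x+d}$ to permute $\mathbb F_{q^2}$ itself (the denominator has no zero in $\mathbb F_{q^2}$). In particular, over all prime powers $q$ together, only finitely many permutation rational functions of this form exist. -/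

import Mathlib

/-- The self-map of `F ∪ {∞}` defined by a rational function `f` over a field `F`.
`RatFunc.num f` and `RatFunc.denom f` are coprime and `RatFunc.denom f` is monic, so
`f.num.leadingCoeff` is the quotient of the leading coefficients. -/
noncomputable def RatFunc.onePointMap {F : Type*} [Field F] (f : RatFunc F) :
    OnePoint F → OnePoint F
  | OnePoint.some x =>
      open Classical in
      if f.denom.eval x = 0 then OnePoint.infty
      else OnePoint.some (f.num.eval x / f.denom.eval x)
  | OnePoint.infty =>
      open Classical in
      if f.denom.degree < f.num.degree then OnePoint.infty
      else if f.num.degree = f.denom.degree then OnePoint.some f.num.leadingCoeff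
      else OnePoint.some 0

/-- `f` is a permutation rational function of `F`: it permutes `F ∪ {∞}`. -/
def RatFunc.IsPermutation {F : Type*} [Field F] (f : RatFunc F) : Prop :=
  Function.Bijective f.onePointMap

/-- The rational function `(α X^(2q) + β X^2 + a X^q + b X + c) / (X^q + X + d)`. -/
noncomputable def secondKind {F : Type*} [Field F] (q : ℕ) (α β a b c d : F) : RatFunc F :=
  (RatFunc.C α * RatFunc.X ^ (2 * q) + RatFunc.C β * RatFunc.X ^ 2 + RatFunc.C a * RatFunc.X ^ q
      + RatFunc.C b * RatFunc.X + RatFunc.C c)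
    / (RatFunc.X ^ q + RatFunc.X + RatFunc.C d)

instance (p : Nat.Primes) : Fact (p : ℕ).Prime := ⟨p.2⟩

/-! Let σ be x ↦ x^q, an involution of F with fixed field K, and let D = d - σ d ≠ 0. The
denominator has no zero and the numerator has larger degree, so f fixes ∞ and restricts to a
self-map of F. Because α = -σ β, adding its conjugate to the equation f(x) = e removes the quadratic
terms: each fibre is cut out on a K-line by a polynomial of degree at most 2. Bijectivity forces a
double root if the leading coefficient is nonzero (`lin_eq_zero`) and a nonzero linear coefficient
otherwise (`lin_ne_zero`). Moving e by t D with t in K preserves the direction of the line, so the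
vanishing discriminant can be compared coefficientwise in t. This yields `normal_form`.

Then f(x) = β (x - σ x) + (a + b)/2 + C/(x + σ x + d). Taking traces, g(τ) = C/(τ + d) + σ C/(τ + σ
d) must be injective on K and reach every nonzero v in K. Since g(τ) = v is quadratic in τ, its
discriminant vanishes for all such v (`discrim_trace_eq_zero`), which forces v² = 1 and K = F_3.
Conversely, over F_3 the map g is, up to a shift and a factor, r ↦ r/(r² + 1), which is injective.
-/

namespace SecondKind

/-! ### Fibres over a field with an involution; necessary conditions. -/

section Involution
variable {F : Type*} [Field F] (σ : F →+* F)

/-- The numerator of `secondKind` as a function, with the Frobenius replaced by `σ`. -/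
def numer (β a b c : F) (x : F) : F := -σ β * σ x ^ 2 + β * x ^ 2 + a * σ x + b * x + c

/-- The denominator of `secondKind` as a function, with the Frobenius replaced by `σ`. -/
def denomin (d : F) (x : F) : F := σ x + x + d

variable {σ} {β a b c d : F}

theorem denomin_ne_zero (hσ : ∀ x, σ (σ x) = x) (hd : σ d ≠ d) (x : F) : denomin σ d x ≠ 0 := by
  intro h
  have h' := congrArg σ h
  simp only [denomin, map_add, hσ, map_zero] at h h'
  exact hd (by linear_combination h' - h)

theorem div_eq_iff_numer (hσ : ∀ x, σ (σ x) = x) (hd : σ d ≠ d) (x e : F) :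
    numer σ β a b c x / denomin σ d x = e ↔
      -σ β * σ x ^ 2 + β * x ^ 2 + (a - e) * σ x + (b - e) * x + (c - e * d) = 0 := by
  rw [div_eq_iff (denomin_ne_zero hσ hd x), ← sub_eq_zero]
  have : numer σ β a b c x - e * denomin σ d x =
      -σ β * σ x ^ 2 + β * x ^ 2 + (a - e) * σ x + (b - e) * x + (c - e * d) := by
    simp only [numer, denomin]; ring
  rw [this]

/-- Adding the conjugate equation eliminates the quadratic terms. -/
theorem trace_equation (hσ : ∀ x, σ (σ x) = x) {x e : F}
    (h : -σ β * σ x ^ 2 + β * x ^ 2 + (a - e) * σ x + (b - e) * x + (c - e * d) = 0) :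
    (σ a + b - e - σ e) * x + (a + σ b - e - σ e) * σ x +
      (c + σ c - e * d - σ e * σ d) = 0 := by
  have h' := congrArg σ h
  simp only [map_add, map_sub, map_mul, map_pow, map_neg, hσ, map_zero] at h'
  linear_combination h + h'

/-- If w = σ a + b were fixed, every e of trace w would have direction 0, leaving a condition on e
free of x; e and e + D cannot both satisfy it. -/
theorem not_fixed_of_surjective (hσ : ∀ x, σ (σ x) = x) (hd : σ d ≠ d)
    (hf : Function.Surjective fun x => numer σ β a b c x / denomin σ d x) :
    σ (σ a + b) ≠ σ a + b := by
  intro hw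
  have hD : d - σ d ≠ 0 := sub_ne_zero.2 hd.symm
  simp only [map_add, hσ] at hw
  have key : ∀ e, e + σ e = σ a + b → c + σ c - e * d - σ e * σ d = 0 := by
    intro e he
    obtain ⟨x, hx⟩ := hf e
    have h := trace_equation hσ ((div_eq_iff_numer hσ hd x e).1 hx)
    linear_combination h + (x + σ x) * he - σ x * hw
  obtain ⟨z, hz⟩ : ∃ z, z + σ z = 1 := by
    refine ⟨d / (d - σ d), ?_⟩
    have hD' : σ d - d ≠ 0 := sub_ne_zero.2 hd
    simp only [map_div₀, map_sub, hσ]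
    field_simp
    ring
  have hz2 : (σ a + b) * z + σ ((σ a + b) * z) = σ a + b := by
    simp only [map_add, map_mul, hσ]
    linear_combination (σ a + b) * hz + σ z * hw
  have h1 := key _ hz2
  have h2 := key ((σ a + b) * z + (d - σ d)) (by
    rw [map_add, map_sub, hσ]; linear_combination hz2)
  rw [map_add, map_sub, hσ] at h2
  exact hD (pow_eq_zero_iff two_ne_zero |>.1 (by linear_combination h1 - h2 : (d - σ d) ^ 2 = 0))

/-- The direction `σ a + b - Tr e` attached to a value `e`. -/
def dir (σ : F →+* F) (a b e : F) : F := σ a + b - e - σ e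

/-- The leading coefficient of the equation restricted to the line attached to `e`. -/
def lead (σ : F →+* F) (β a b e : F) : F :=
  β * σ (dir σ a b e) ^ 2 - σ β * dir σ a b e ^ 2

/-- The linear coefficient at `x` of the equation restricted to the line attached to `e`. -/
def lin (σ : F →+* F) (β a b e x : F) : F :=
  2 * (β * x * σ (dir σ a b e) + σ β * σ x * dir σ a b e) +
    (b - e) * σ (dir σ a b e) - (a - e) * dir σ a b e

theorem dir_ne_zero (hσ : ∀ x, σ (σ x) = x) (hw : σ (σ a + b) ≠ σ a + b) (e : F) :
    dir σ a b e ≠ 0 := by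
  intro h
  have h' := congrArg σ h
  simp only [dir, map_add, map_sub, map_zero, hσ] at h h' hw
  exact hw (by linear_combination h' - h)

/-- Moving x to x + r D σ(u), where u is the direction, adds r D (`lin` + r D `lead`) to the fibre
equation. -/
theorem line_injective (hσ : ∀ x, σ (σ x) = x) (hd : σ d ≠ d) (hw : σ (σ a + b) ≠ σ a + b)
    (hf : Function.Injective fun x => numer σ β a b c x / denomin σ d x) {x e r : F}
    (hx : numer σ β a b c x / denomin σ d x = e) (hr : σ r = r)
    (h : lin σ β a b e x + r * (d - σ d) * lead σ β a b e = 0) : r = 0 := by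
  have hx' := (div_eq_iff_numer hσ hd x e).1 hx
  have h2 : numer σ β a b c (x + r * ((d - σ d) * σ (dir σ a b e))) /
      denomin σ d (x + r * ((d - σ d) * σ (dir σ a b e))) = e := by
    rw [div_eq_iff_numer hσ hd]
    simp only [lin, lead] at h
    simp only [map_add, map_sub, map_mul, hσ, hr]
    linear_combination hx' + r * (d - σ d) * h
  have h3 := hf (h2.trans hx.symm)
  have hu : σ (dir σ a b e) ≠ 0 := by simpa using dir_ne_zero hσ hw e
  have hD : d - σ d ≠ 0 := sub_ne_zero.2 hd.symm
  simpa [hu, hD] using h3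

theorem lin_ne_zero (hσ : ∀ x, σ (σ x) = x) (hd : σ d ≠ d) (hw : σ (σ a + b) ≠ σ a + b)
    (hf : Function.Injective fun x => numer σ β a b c x / denomin σ d x) {x e : F}
    (hx : numer σ β a b c x / denomin σ d x = e) (hM : lead σ β a b e = 0) :
    lin σ β a b e x ≠ 0 := fun h =>
  one_ne_zero (line_injective hσ hd hw hf hx (map_one σ) (by rw [h, hM]; ring))

theorem conj_lead (hσ : ∀ x, σ (σ x) = x) (e : F) : σ (lead σ β a b e) = -lead σ β a b e := by
  simp only [lead, map_sub, map_mul, map_pow, hσ]; ring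

theorem conj_lin (hσ : ∀ x, σ (σ x) = x) (e x : F) :
    σ (lin σ β a b e x) = lin σ β a b e x := by
  simp only [lin, dir, map_sub, map_mul, map_add, map_ofNat, hσ]; ring

theorem lin_eq_zero (hσ : ∀ x, σ (σ x) = x) (hd : σ d ≠ d) (hw : σ (σ a + b) ≠ σ a + b)
    (hf : Function.Injective fun x => numer σ β a b c x / denomin σ d x) {x e : F}
    (hx : numer σ β a b c x / denomin σ d x = e) (hM : lead σ β a b e ≠ 0) :
    lin σ β a b e x = 0 := by
  have hD : d - σ d ≠ 0 := sub_ne_zero.2 hd.symm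
  have h := line_injective hσ hd hw hf (r := -lin σ β a b e x / ((d - σ d) * lead σ β a b e)) hx
    (by
      rw [map_div₀, map_neg, conj_lin hσ, map_mul, conj_lead hσ, map_sub, hσ]
      congr 1; ring)
    (by field_simp; ring)
  simpa [hD, hM] using h

/-- When `lead` vanishes, the trace equation makes `lin` at the solution depend on e alone.
Replacing e by e + t D keeps `lead` zero and makes `lin` affine in t; a nonzero slope would let some
t annihilate it. -/
theorem relation_of_lead_eq_zero (hσ : ∀ x, σ (σ x) = x) (hd : σ d ≠ d)
    (hw : σ (σ a + b) ≠ σ a + b)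
    (hf : Function.Bijective fun x => numer σ β a b c x / denomin σ d x) {e : F}
    (hM : lead σ β a b e = 0) :
    2 * β * σ (dir σ a b e) * (d - σ d) +
      (σ a + b - σ (σ a + b)) * dir σ a b e = 0 := by
  have hu := dir_ne_zero hσ hw e
  have hu' : σ (dir σ a b e) ≠ 0 := by simpa using hu
  set u := dir σ a b e with hudef
  have hD : d - σ d ≠ 0 := sub_ne_zero.2 hd.symm
  -- Vanishing of `lead` says exactly that β σ(u)/u is fixed by σ.
  obtain ⟨ρ, hρ⟩ : ∃ ρ, ρ * u = β * σ u := ⟨β * σ u / u, by field_simp⟩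
  have hM' : β * σ u ^ 2 = σ β * u ^ 2 := sub_eq_zero.1 hM
  have hρσ : ρ * σ u = σ β * u := mul_right_cancel₀ hu (by linear_combination σ u * hρ + hM')
  have hρf : σ ρ = ρ := by
    have := congrArg σ hρσ
    simp only [map_mul, hσ] at this
    exact mul_right_cancel₀ hu (by rw [this, hρ])
  by_contra hne
  have hne' : 2 * ρ * (d - σ d) + (σ a + b - σ (σ a + b)) ≠ 0 := by
    intro h0
    exact hne (by linear_combination u * h0 - 2 * (d - σ d) * hρ)
  set W := σ a + b - σ (σ a + b) with hW
  have hWσ : σ W = -W := by rw [hW, map_sub, hσ]; ring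
  set L := -2 * ρ * (c + σ c - e * d - σ e * σ d) + (b - e) * σ u - (a - e) * u with hL
  have hLσ : σ L = L := by
    simp only [hL, hudef, dir, map_sub, map_mul, map_add, map_neg, map_ofNat, hσ, hρf]; ring
  set t := -L / ((d - σ d) * (2 * ρ * (d - σ d) + W)) with ht
  have htσ : σ t = t := by
    rw [ht, map_div₀, map_neg, hLσ, map_mul, map_add, hWσ]
    simp only [map_mul, map_sub, map_ofNat, hσ, hρf]
    congr 1; ring
  have htL : t * ((d - σ d) * (2 * ρ * (d - σ d) + W)) = -L := by
    exact div_mul_cancel₀ _ (mul_ne_zero hD hne')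
  have hdir : dir σ a b (e + t * (d - σ d)) = u := by
    simp only [hudef, dir, map_add, map_mul, map_sub, hσ, htσ]; ring
  obtain ⟨x, hx⟩ := hf.2 (e + t * (d - σ d))
  have hM2 : lead σ β a b (e + t * (d - σ d)) = 0 := by
    rw [lead, hdir]; linear_combination hM'
  refine lin_ne_zero hσ hd hw hf.1 hx hM2 ?_
  have hT := trace_equation hσ ((div_eq_iff_numer hσ hd x _).1 hx)
  have hT2 : u * x + σ u * σ x +
      (c + σ c - e * d - σ e * σ d - t * (d - σ d) ^ 2) = 0 := by
    simp only [hudef, dir, map_add, map_mul, map_sub, hσ, htσ] at hT ⊢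
    linear_combination hT
  have hWu : W = u - σ u := by
    simp only [hW, hudef, dir, map_add, map_sub, hσ]; ring
  rw [lin, hdir]
  rw [hL] at htL
  linear_combination 2 * ρ * hT2 + htL - 2 * x * hρ - 2 * σ x * hρσ - t * (d - σ d) * hWu

/-- The previous relation is affine in the trace of e. Holding at two traces, it forces 2βD + W = 0
with W = w - σ w, and then W² = 0. -/
theorem lead_ne_zero_or (hσ : ∀ x, σ (σ x) = x) (hd : σ d ≠ d)
    (hw : σ (σ a + b) ≠ σ a + b)
    (hf : Function.Bijective fun x => numer σ β a b c x / denomin σ d x) {e e' : F}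
    (he : e + σ e ≠ e' + σ e') : lead σ β a b e ≠ 0 ∨ lead σ β a b e' ≠ 0 := by
  by_contra! h
  have h1 := relation_of_lead_eq_zero hσ hd hw hf h.1
  have h2 := relation_of_lead_eq_zero hσ hd hw hf h.2
  have hs : e + σ e - (e' + σ e') ≠ 0 := sub_ne_zero.2 he
  have h3 : 2 * β * (d - σ d) + (σ a + b - σ (σ a + b)) = 0 := by
    refine (mul_eq_zero.1 (?_ : (e + σ e - (e' + σ e')) * _ = 0)).resolve_left hs
    simp only [dir, map_sub, map_add, hσ] at h1 h2 ⊢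
    linear_combination h2 - h1
  have h4 : (σ a + b - σ (σ a + b)) ^ 2 = 0 := by
    simp only [dir, map_sub, map_add, hσ] at h1 h3 ⊢
    linear_combination h1 - (a + σ b - e - σ e) * h3
  exact hw (sub_eq_zero.1 (pow_eq_zero_iff two_ne_zero |>.1 h4)).symm

/-- If 2 = 0, the relation becomes W u = 0, so `lead` never vanishes. Then `lin`, now free of x, is
zero at both e = 0 and e = D, yet differs there by D W. -/
theorem two_ne_zero_of_bijective (hσ : ∀ x, σ (σ x) = x) (hd : σ d ≠ d)
    (hw : σ (σ a + b) ≠ σ a + b)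
    (hf : Function.Bijective fun x => numer σ β a b c x / denomin σ d x) : (2 : F) ≠ 0 := by
  intro h2
  have hW : σ a + b - σ (σ a + b) ≠ 0 := sub_ne_zero.2 hw.symm
  have hM : ∀ e, lead σ β a b e ≠ 0 := by
    intro e hM
    have h := relation_of_lead_eq_zero hσ hd hw hf hM
    rw [h2] at h
    have := dir_ne_zero hσ hw e
    simp_all
  have hD : d - σ d ≠ 0 := sub_ne_zero.2 hd.symm
  obtain ⟨x, hx⟩ := hf.2 0
  obtain ⟨y, hy⟩ := hf.2 (d - σ d)
  have h0 := lin_eq_zero hσ hd hw hf.1 hx (hM _)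
  have h1 := lin_eq_zero hσ hd hw hf.1 hy (hM _)
  have : (d - σ d) * (σ a + b - σ (σ a + b)) = 0 := by
    simp only [lin, h2, dir, map_add, map_sub, map_zero, hσ] at h0 h1 ⊢
    linear_combination h1 - h0
  simp_all

/-- The discriminant of the equation on the line attached to `e` vanishes. -/
theorem discrim_eq_zero (hσ : ∀ x, σ (σ x) = x) (hd : σ d ≠ d)
    (hw : σ (σ a + b) ≠ σ a + b)
    (hf : Function.Bijective fun x => numer σ β a b c x / denomin σ d x) {e : F}
    (hM : lead σ β a b e ≠ 0) :
    4 * β * σ β * (c + σ c - e * d - σ e * σ d) ^ 2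
      - 4 * (c + σ c - e * d - σ e * σ d) *
        ((b - e) * σ β * dir σ a b e - (a - e) * β * σ (dir σ a b e))
      + ((b - e) * σ (dir σ a b e) - (a - e) * dir σ a b e) ^ 2
      - 4 * lead σ β a b e * (c - e * d) = 0 := by
  obtain ⟨x, hx⟩ := hf.2 e
  have hE := (div_eq_iff_numer hσ hd x e).1 hx
  have hT := trace_equation hσ hE
  have hL := lin_eq_zero hσ hd hw hf.1 hx hM
  have hT2 : c + σ c - e * d - σ e * σ d = -(dir σ a b e * x + σ (dir σ a b e) * σ x) := by
    simp only [dir, map_add, map_sub, hσ]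
    linear_combination hT
  rw [hT2]
  rw [lin] at hL
  rw [lead]
  generalize dir σ a b e = u at *
  linear_combination (2 * (β * x * σ u + σ β * σ x * u) + ((b - e) * σ u - (a - e) * u)) * hL
    - 4 * (β * σ u ^ 2 - σ β * u ^ 2) * hE

/-- At e + t D the discriminant is quadratic in t; its zeros at t = 0, 1, -1 kill the t² and t
coefficients, given here up to powers of D and using 2 ≠ 0. -/
theorem discrim_coeffs (hσ : ∀ x, σ (σ x) = x) (hd : σ d ≠ d)
    (hw : σ (σ a + b) ≠ σ a + b)
    (hf : Function.Bijective fun x => numer σ β a b c x / denomin σ d x) {e : F}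
    (hM : lead σ β a b e ≠ 0) :
    4 * β * σ β * (d - σ d) ^ 2
      - 4 * (d - σ d) * (σ β * dir σ a b e - β * σ (dir σ a b e))
      + (σ a + b - σ (σ a + b)) ^ 2 = 0 ∧
    -8 * β * σ β * (c + σ c - e * d - σ e * σ d) * (d - σ d)
      + 4 * (d - σ d) * ((b - e) * σ β * dir σ a b e - (a - e) * β * σ (dir σ a b e))
      + 4 * (c + σ c - e * d - σ e * σ d) * (σ β * dir σ a b e - β * σ (dir σ a b e))
      + 2 * (σ a + b - σ (σ a + b)) * ((b - e) * σ (dir σ a b e) - (a - e) * dir σ a b e)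
      + 4 * lead σ β a b e * d = 0 := by
  have h2 := two_ne_zero_of_bijective hσ hd hw hf
  have hD : d - σ d ≠ 0 := sub_ne_zero.2 hd.symm
  have hdir : ∀ t, σ t = t → dir σ a b (e + t * (d - σ d)) = dir σ a b e := by
    intro t ht
    simp only [dir, map_add, map_mul, map_sub, hσ, ht]; ring
  have hW : σ a + b - σ (σ a + b) = dir σ a b e - σ (dir σ a b e) := by
    simp only [dir, map_add, map_sub, hσ]; ring
  have hlead : ∀ t, σ t = t → lead σ β a b (e + t * (d - σ d)) = lead σ β a b e := by
    intro t ht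
    rw [lead, hdir t ht, lead]
  have h0 := discrim_eq_zero hσ hd hw hf hM
  have h1 := discrim_eq_zero hσ hd hw hf (e := e + 1 * (d - σ d))
    (by rwa [hlead _ (map_one σ)])
  have h1' := discrim_eq_zero hσ hd hw hf (e := e + -1 * (d - σ d))
    (by rwa [hlead _ (by simp)])
  rw [hlead _ (map_one σ), hdir _ (map_one σ)] at h1
  rw [hlead _ (by simp), hdir _ (by simp)] at h1'
  rw [hW]
  simp only [map_add, map_mul, map_sub, map_neg, map_one, hσ] at h1 h1'
  generalize dir σ a b e = u at *
  generalize lead σ β a b e = M at *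
  constructor
  · refine mul_left_cancel₀ (mul_ne_zero h2 (pow_ne_zero 2 hD)) ?_
    linear_combination h1 + h1' - 2 * h0
  · refine mul_left_cancel₀ (mul_ne_zero h2 hD) ?_
    linear_combination h1 - h1'

theorem normal_form (hσ : ∀ x, σ (σ x) = x) (hd : σ d ≠ d)
    (hw : σ (σ a + b) ≠ σ a + b)
    (hf : Function.Bijective fun x => numer σ β a b c x / denomin σ d x) :
    σ β = β ∧ b - a = 2 * β * d := by
  have h2 := two_ne_zero_of_bijective hσ hd hw hf
  have hD : d - σ d ≠ 0 := sub_ne_zero.2 hd.symm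
  -- The elements 0, 1, -1 have distinct traces 0, 2, -2, so `lead` vanishes at no more than one of
  -- them.
  obtain ⟨e, e', hee, hM, hM'⟩ : ∃ e e', e + σ e ≠ e' + σ e' ∧
      lead σ β a b e ≠ 0 ∧ lead σ β a b e' ≠ 0 := by
    have h01 : (0 : F) + σ 0 ≠ 1 + σ 1 := by
      rw [map_zero, map_one, add_zero, one_add_one_eq_two]; exact h2.symm
    have h02 : (0 : F) + σ 0 ≠ -1 + σ (-1) := by
      rw [map_zero, map_neg, map_one]; intro h; exact h2 (by linear_combination h)
    have h12 : (1 : F) + σ 1 ≠ -1 + σ (-1) := by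
      rw [map_neg, map_one]; intro h
      exact mul_ne_zero h2 h2 (by linear_combination h)
    have k01 := lead_ne_zero_or hσ hd hw hf h01
    have k02 := lead_ne_zero_or hσ hd hw hf h02
    have k12 := lead_ne_zero_or hσ hd hw hf h12
    by_cases h0 : lead σ β a b 0 = 0
    · exact ⟨_, _, h12, k01.resolve_left (not_not.2 h0), k02.resolve_left (not_not.2 h0)⟩
    · rcases k12 with h | h
      · exact ⟨_, _, h01, h0, h⟩
      · exact ⟨_, _, h02, h0, h⟩
  obtain ⟨hq, hl⟩ := discrim_coeffs hσ hd hw hf hM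
  obtain ⟨hq', -⟩ := discrim_coeffs hσ hd hw hf hM'
  have hβσ : σ β = β := by
    have h4 : 2 * 2 * (d - σ d) * (e + σ e - (e' + σ e')) * (σ β - β) = 0 := by
      simp only [dir, map_add, map_sub, hσ] at hq hq'
      linear_combination hq - hq'
    have hs : e + σ e - (e' + σ e') ≠ 0 := sub_ne_zero.2 hee
    exact sub_eq_zero.1 ((mul_eq_zero.1 h4).resolve_left
      (mul_ne_zero (mul_ne_zero (mul_ne_zero h2 h2) hD) hs))
  refine ⟨hβσ, ?_⟩
  have hW : σ a + b - σ (σ a + b) = dir σ a b e - σ (dir σ a b e) := by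
    simp only [dir, map_add, map_sub, hσ]; ring
  have hWne : dir σ a b e - σ (dir σ a b e) ≠ 0 := hW ▸ sub_ne_zero.2 hw.symm
  have hM2 : lead σ β a b e =
      -(β * (dir σ a b e - σ (dir σ a b e)) * (dir σ a b e + σ (dir σ a b e))) := by
    rw [lead, hβσ]; ring
  rw [hM2] at hM hl
  rw [hW] at hq hl
  rw [hβσ] at hq hl
  generalize dir σ a b e = u at *
  have hsum : u + σ u ≠ 0 := by
    intro h; rw [h] at hM; simp at hM
  -- With β fixed, the t² coefficient is the square (W - 2βD)².
  have hWD : u - σ u = 2 * β * (d - σ d) := by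
    refine (sub_eq_zero.1 (pow_eq_zero_iff two_ne_zero |>.1 ?_))
    linear_combination hq
  refine sub_eq_zero.1 ((mul_eq_zero.1 (?_ : 2 * (u - σ u) * (u + σ u) * _ = 0)).resolve_left
    (mul_ne_zero (mul_ne_zero h2 hWne) hsum))
  linear_combination hl + (2 * ((b - e) * u - (a - e) * σ u)
    - 4 * β * (c + σ c - e * d - σ e * σ d)) * hWD

/-! ### Reduction to a map on the fixed field. -/

theorem div_eq_of_normal_form (hσ : ∀ x, σ (σ x) = x) (hd : σ d ≠ d) (h2 : (2 : F) ≠ 0)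
    (hβ : σ β = β) (hab : b - a = 2 * β * d) (x : F) :
    numer σ β a b c x / denomin σ d x =
      β * (x - σ x) + (a + b) / 2 + (c - d * (a + b) / 2) / (σ x + x + d) := by
  have h := denomin_ne_zero hσ hd x
  rw [denomin] at *
  rw [numer, hβ]
  field_simp
  linear_combination (x - σ x) * hab

theorem discrim_trace_eq_zero (hσ : ∀ x, σ (σ x) = x) (hd : σ d ≠ d) (h2 : (2 : F) ≠ 0)
    (hβ0 : β ≠ 0) (hβ : σ β = β) (hab : b - a = 2 * β * d)
    (hf : Function.Bijective fun x => numer σ β a b c x / denomin σ d x)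
    {C : F} (hC : C = c - d * (a + b) / 2) {v : F} (hv : σ v = v) (hv0 : v ≠ 0) :
    v ^ 2 * (d - σ d) ^ 2 - 2 * v * (C - σ C) * (d - σ d) + (C + σ C) ^ 2 = 0 := by
  have hf' : ∀ x, numer σ β a b c x / denomin σ d x =
      β * (x - σ x) + (a + b) / 2 + C / (σ x + x + d) := by
    rw [hC]; exact div_eq_of_normal_form hσ hd h2 hβ hab
  have hne : ∀ τ, σ τ = τ → τ + d ≠ 0 := by
    intro τ hτ h
    have h' := congrArg σ h
    simp only [map_add, hτ, map_zero] at h'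
    exact hd (by linear_combination h' - h)
  have hne' : ∀ τ, σ τ = τ → τ + σ d ≠ 0 := by
    intro τ hτ h
    exact hne τ hτ (by simpa [hσ, hτ] using congrArg σ h)
  have h2σ : σ 2 = 2 := map_ofNat σ 2
  have inj : ∀ τ τ', σ τ = τ → σ τ' = τ' →
      C / (τ + d) + σ C / (τ + σ d) = C / (τ' + d) + σ C / (τ' + σ d) → τ = τ' := by
    intro τ τ' hτ hτ' h
    -- The points τ/2 and (τ' + η)/2 have traces τ and τ'. Equality of g at τ and τ' makes η
    -- antisymmetric, and β η compensates the difference of the fractions, so f agrees at both.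
    set η := (C / (τ + d) - C / (τ' + d)) / β with hη
    have hησ : σ η = -η := by
      simp only [hη, map_div₀, map_sub, map_add, hβ, hτ, hτ']
      field_simp
      linear_combination h
    have e1 : σ (τ / 2) = τ / 2 := by simp [hτ, h2σ]
    have e2 : σ ((τ' + η) / 2) = (τ' - η) / 2 := by simp [hτ', hησ, h2σ, sub_eq_add_neg]
    have hx : τ / 2 = (τ' + η) / 2 := by
      apply hf.1
      simp only [hf', e1, e2]
      have s1 : τ / 2 + τ / 2 = τ := by field_simp; ring
      have s2 : (τ' - η) / 2 + (τ' + η) / 2 = τ' := by field_simp; ring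
      have s3 : β * ((τ' + η) / 2 - (τ' - η) / 2) = C / (τ + d) - C / (τ' + d) := by
        rw [hη]; field_simp; ring
      rw [s1, s2, s3]; ring
    have hx' := congrArg σ hx
    rw [e1, e2] at hx'
    field_simp at hx hx'
    exact mul_right_cancel₀ h2 (by linear_combination hx + hx')
  obtain ⟨x, hx⟩ := hf.2 (v / 2 + (a + b) / 2)
  simp only [hf'] at hx
  set τ := σ x + x with hτdef
  have hτ : σ τ = τ := by simp only [hτdef, map_add, hσ]; ring
  have hxe : β * (x - σ x) + C / (τ + d) = v / 2 := by linear_combination hx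
  have hxσ := congrArg σ hxe
  simp only [map_add, map_mul, map_sub, map_div₀, hσ, hβ, hτ, hv, h2σ] at hxσ
  have hg : C / (τ + d) + σ C / (τ + σ d) = v := by
    have : v / 2 + v / 2 = v := by field_simp; ring
    linear_combination hxe + hxσ + this
  have n1 := hne τ hτ
  have n2 := hne' τ hτ
  have hq : v * ((τ + d) * (τ + σ d)) = C * (τ + σ d) + σ C * (τ + d) := by
    rw [← hg]; field_simp
  -- The other root of g(τ) = v, by Vieta.
  set τ' := -τ - (d + σ d) + (C + σ C) / v with hτ'def
  have hτ' : σ τ' = τ' := by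
    simp only [hτ'def, map_add, map_sub, map_neg, map_div₀, hτ, hσ, hv]; ring
  have hsum : v * (τ' + τ + (d + σ d)) = C + σ C := by
    rw [hτ'def]; field_simp; ring
  have m1 := hne τ' hτ'
  have m2 := hne' τ' hτ'
  have hg' : C / (τ' + d) + σ C / (τ' + σ d) = v := by
    rw [div_add_div _ _ m1 m2, div_eq_iff (mul_ne_zero m1 m2)]
    linear_combination (τ - τ') * hsum - hq
  have heq := inj τ τ' hτ hτ' (hg.trans hg'.symm)
  rw [← heq] at hsum
  linear_combination (v * (2 * τ + d + σ d) - (C + σ C)) * hsum - 4 * v * hq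

theorem necessary_conditions (hσ : ∀ x, σ (σ x) = x) (hd : σ d ≠ d) (hβ0 : β ≠ 0)
    (hf : Function.Bijective fun x => numer σ β a b c x / denomin σ d x) :
    (2 : F) ≠ 0 ∧ σ (σ a + b) ≠ σ a + b ∧ σ β = β ∧ b - a = 2 * β * d ∧
      (∀ v, σ v = v → v ≠ 0 → v ^ 2 = 1) ∧
      (2 * c - d * (a + b)) ^ 2 = -(d - σ d) ^ 2 := by
  have hw := not_fixed_of_surjective hσ hd hf.2
  have h2 := two_ne_zero_of_bijective hσ hd hw hf
  obtain ⟨hβ, hab⟩ := normal_form hσ hd hw hf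
  have hD : d - σ d ≠ 0 := sub_ne_zero.2 hd.symm
  have key := fun v hv hv0 => discrim_trace_eq_zero hσ hd h2 hβ0 hβ hab hf rfl (v := v) hv hv0
  set C := c - d * (a + b) / 2 with hC
  -- Comparing v = 1 and v = -1 gives σ C = C; what remains is v² D² = -4C² for every nonzero fixed
  -- v.
  have h1 := key 1 (map_one σ) one_ne_zero
  have h1' := key (-1) (by simp) (by simp)
  have hCσ : C - σ C = 0 := by
    refine (mul_eq_zero.1 (?_ : 2 * 2 * (d - σ d) * (C - σ C) = 0)).resolve_left
      (mul_ne_zero (mul_ne_zero h2 h2) hD)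
    linear_combination h1' - h1
  refine ⟨h2, hw, hβ, hab, fun v hv hv0 => ?_, ?_⟩
  · refine mul_right_cancel₀ (pow_ne_zero 2 hD) ?_
    linear_combination key v hv hv0 - h1 + 2 * (v - 1) * (d - σ d) * hCσ
  · have : 2 * c - d * (a + b) = 2 * C := by rw [hC]; field_simp
    rw [this]
    linear_combination h1 + (2 * (d - σ d) + (3 * C + σ C)) * hCσ

end Involution

/-! ### Injectivity in characteristic 3. -/

section Sufficiency
variable {F : Type*} [Field F] {σ : F →+* F} {β a b c d : F}

theorem injective_of_char_three (hσ : ∀ x, σ (σ x) = x) (hd : σ d ≠ d) (h3 : (3 : F) = 0)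
    (hK : ∀ x, σ x = x → x ≠ 0 → x ^ 2 = 1) (hβ : σ β = β) (hβ2 : β ^ 2 = 1)
    (hD2 : (d - σ d) ^ 2 = -1) (hab : b - a = 2 * β * d) {C : F}
    (hC : C = c - d * (a + b) / 2) (hCσ : σ C = C) (hC0 : C ≠ 0) :
    Function.Injective fun x => numer σ β a b c x / denomin σ d x := by
  have h2 : (2 : F) ≠ 0 := fun h => one_ne_zero (by linear_combination h3 - h : (1 : F) = 0)
  have hβ0 : β ≠ 0 := by rintro rfl; simp at hβ2
  have hD : d - σ d ≠ 0 := sub_ne_zero.2 hd.symm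
  intro x y hxy
  simp only [div_eq_of_normal_form hσ hd h2 hβ hab, ← hC] at hxy
  set τ := σ x + x with hτdef
  set τ' := σ y + y with hτ'def
  have hτ : σ τ = τ := by simp only [hτdef, map_add, hσ]; ring
  have hτ' : σ τ' = τ' := by simp only [hτ'def, map_add, hσ]; ring
  have m1 : τ + d ≠ 0 := denomin_ne_zero hσ hd x
  have m2 : τ' + d ≠ 0 := denomin_ne_zero hσ hd y
  have m1' : τ + σ d ≠ 0 := by simpa [hτ] using (map_ne_zero σ).2 m1
  have m2' : τ' + σ d ≠ 0 := by simpa [hτ'] using (map_ne_zero σ).2 m2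
  have h1 : β * (x - σ x) + C / (τ + d) = β * (y - σ y) + C / (τ' + d) := by
    linear_combination hxy
  have h1σ := congrArg σ h1
  simp only [map_add, map_mul, map_sub, map_div₀, hσ, hβ, hτ, hτ', hCσ] at h1σ
  have hT : C * (1 / (τ + d) + 1 / (τ + σ d) - (1 / (τ' + d) + 1 / (τ' + σ d))) = 0 := by
    linear_combination h1 + h1σ
  replace hT := (mul_eq_zero.1 hT).resolve_left hC0
  -- In characteristic 3 the shift r = τ - (d + σ d) gives τ + d = r - D and τ + σ d = r + D. The
  -- sum of inverses is then 2r/(r² - D²) = 2r/(r² + 1), which equals r on F_3.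
  have hττ : τ = τ' := by
    have shift : ∀ t, σ t = t → σ (t - (d + σ d)) = t - (d + σ d) := by
      intro t ht
      simp only [map_sub, map_add, ht, hσ]; ring
    have k1 := shift τ hτ
    have k2 := shift τ' hτ'
    have e1 : ∀ t, t + d = t - (d + σ d) - (d - σ d) := fun t => by linear_combination d * h3
    have e2 : ∀ t, t + σ d = t - (d + σ d) + (d - σ d) := fun t => by linear_combination σ d * h3
    rw [e1 τ] at m1 hT
    rw [e1 τ'] at m2 hT
    rw [e2 τ] at m1' hT
    rw [e2 τ'] at m2' hT
    suffices τ - (d + σ d) = τ' - (d + σ d) from sub_left_injective this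
    generalize τ - (d + σ d) = r at *
    generalize τ' - (d + σ d) = r' at *
    generalize d - σ d = D at *
    field_simp at hT
    have hT' : r * (r' ^ 2 + 1) = r' * (r ^ 2 + 1) :=
      mul_left_cancel₀ h2 (by linear_combination hT + 2 * (r - r') * hD2)
    by_cases hr : r = 0
    · rw [hr] at hT' ⊢; linear_combination hT'
    · by_cases hr' : r' = 0
      · rw [hr'] at hT' ⊢; linear_combination hT'
      · rw [hK r k1 hr, hK r' k2 hr'] at hT'
        exact mul_left_cancel₀ h2 (by linear_combination hT')
  rw [hττ] at h1
  have h4 : x - σ x = y - σ y := mul_left_cancel₀ hβ0 (by linear_combination h1)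
  exact mul_left_cancel₀ h2 (by linear_combination h4 + hττ + hτdef - hτ'def)

end Sufficiency

/-! ### Frobenius as the involution, and the criterion on F. -/

section FiniteField
variable {F : Type*} [Field F] [Finite F] (K : Subfield F)

/-- The Frobenius endomorphism `x ↦ x ^ |K|` of a finite extension of a finite field `K`. -/
noncomputable def frob : F →+* F :=
  letI := Fintype.ofFinite K
  (FiniteField.frobeniusAlgHom K F : F →+* F)

theorem frob_apply (x : F) : frob K x = x ^ Nat.card K := by
  let := Fintype.ofFinite K
  rw [Nat.card_eq_fintype_card]
  rfl

theorem frob_frob (hK : Module.finrank K F = 2) (x : F) : frob K (frob K x) = x := by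
  let := Fintype.ofFinite F
  rw [frob_apply, frob_apply, ← pow_mul, ← sq, ← hK, ← Module.natCard_eq_pow_finrank,
    Nat.card_eq_fintype_card, FiniteField.pow_card]

/-- K already supplies as many roots of X^|K| - X as its degree allows. -/
theorem frob_eq_self_iff {x : F} : frob K x = x ↔ x ∈ K := by
  classical
  let := Fintype.ofFinite F
  let := Fintype.ofFinite K
  rw [frob_apply]
  have hq : 1 < Nat.card K := Finite.one_lt_card
  have hmem : ∀ y ∈ K, y ^ Nat.card K = y := by
    intro y hy
    have := FiniteField.pow_card (⟨y, hy⟩ : K)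
    rw [Nat.card_eq_fintype_card]
    exact congrArg Subtype.val this
  refine ⟨fun hx => ?_, hmem x⟩
  have hp0 : (Polynomial.X ^ Nat.card K - Polynomial.X : Polynomial F) ≠ 0 :=
    FiniteField.X_pow_card_sub_X_ne_zero F hq
  have hsub : (K : Set F).toFinset ⊆
      (Polynomial.X ^ Nat.card K - Polynomial.X : Polynomial F).roots.toFinset := by
    intro y hy
    simp only [Set.mem_toFinset, SetLike.mem_coe] at hy
    rw [Multiset.mem_toFinset, Polynomial.mem_roots hp0, Polynomial.IsRoot.def,
      Polynomial.eval_sub, Polynomial.eval_pow, Polynomial.eval_X, hmem y hy, sub_self]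
  have heq := Finset.eq_of_subset_of_card_le hsub (by
    refine (Multiset.toFinset_card_le _).trans ((Polynomial.card_roots' _).trans ?_)
    rw [FiniteField.X_pow_card_sub_X_natDegree_eq F hq, Set.toFinset_card,
      Nat.card_eq_fintype_card]
    rfl)
  have : x ∈ (K : Set F).toFinset := by
    rw [heq, Multiset.mem_toFinset, Polynomial.mem_roots hp0, Polynomial.IsRoot.def,
      Polynomial.eval_sub, Polynomial.eval_pow, Polynomial.eval_X, hx, sub_self]
  simpa using this

variable {K}

theorem natCard_eq_three {F : Type*} [Field F] {K : Subfield F} (h2 : (2 : F) ≠ 0) (h : ∀ v ∈ K, v ≠ 0 → v ^ 2 = 1) :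
    Nat.card K = 3 := by
  have hset : (K : Set F) = {0, 1, -1} := by
    ext x
    simp only [SetLike.mem_coe, Set.mem_insert_iff, Set.mem_singleton_iff]
    constructor
    · intro hx
      by_cases hx0 : x = 0
      · exact Or.inl hx0
      · exact Or.inr (mul_self_eq_one_iff.1 (by rw [← sq]; exact h x hx hx0))
    · rintro (rfl | rfl | rfl)
      · exact zero_mem K
      · exact one_mem K
      · exact neg_mem (one_mem K)
  have h11 : (1 : F) ≠ -1 := fun h => h2 (by linear_combination h)
  have : (K : Set F).ncard = 3 := by
    rw [hset, Set.ncard_eq_three]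
    exact ⟨0, 1, -1, by simp, by simp, h11, rfl⟩
  exact this

theorem three_eq_zero (h : Nat.card K = 3) : (3 : F) = 0 := by
  let := Fintype.ofFinite K
  have h' : ((3 : ℕ) : K) = 0 := by rw [← h, Nat.card_eq_fintype_card, Nat.cast_card_eq_zero]
  have h'' := congrArg K.subtype h'
  rwa [map_natCast, map_zero, Nat.cast_ofNat] at h''

theorem bijective_iff {q : ℕ} (hq : Nat.card K = q) (hK : Module.finrank K F = 2)
    {α β a b c d : F} (hd : d ∉ K) (hα : α = -β ^ q) (hα0 : α ≠ 0) :
    Function.Bijective (fun x : F =>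
        (α * x ^ (2 * q) + β * x ^ 2 + a * x ^ q + b * x + c) / (x ^ q + x + d)) ↔
      (q = 3 ∧ a ^ q + b ∉ K ∧ β ^ 2 = 1 ∧ (b ^ 2 - a ^ 2 - β * c) ^ 2 = 1 ∧
        β * (a - b) - d = 0) := by
  have hσ := frob_frob K hK
  have hβ0 : β ≠ 0 := by
    rintro rfl
    refine hα0 ?_
    rw [hα, zero_pow (hq ▸ Nat.card_pos.ne'), neg_zero]
  have hd' : frob K d ≠ d := fun h => hd ((frob_eq_self_iff K).1 h)
  have hfun : (fun x : F =>
      (α * x ^ (2 * q) + β * x ^ 2 + a * x ^ q + b * x + c) / (x ^ q + x + d)) =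
      fun x => numer (frob K) β a b c x / denomin (frob K) d x := by
    funext x
    rw [numer, denomin, frob_apply, frob_apply, hq, hα, mul_comm 2 q, pow_mul]
  rw [hfun]
  have hD : d - frob K d ≠ 0 := sub_ne_zero.2 hd'.symm
  have hDσ : frob K (d - frob K d) = -(d - frob K d) := by rw [map_sub, hσ]; ring
  -- Here D³ = σ D = -D.
  have hD2 : q = 3 → (d - frob K d) ^ 2 = -1 := by
    rintro rfl
    rw [frob_apply, hq] at hDσ
    exact mul_right_cancel₀ hD (by linear_combination hDσ)
  have hK3 : q = 3 → ∀ x, frob K x = x → x ≠ 0 → x ^ 2 = 1 := by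
    rintro rfl x hx hx0
    rw [frob_apply, hq] at hx
    exact mul_right_cancel₀ hx0 (by linear_combination hx)
  constructor
  · intro hf
    obtain ⟨h2, hw, hβ, hab, hv, hC⟩ := necessary_conditions hσ hd' hβ0 hf
    have hq3 : q = 3 := by
      rw [← hq]
      exact natCard_eq_three h2 fun v hv' hv0 => hv v ((frob_eq_self_iff K).2 hv') hv0
    have h3 : (3 : F) = 0 := three_eq_zero (hq.trans hq3)
    have hβ2 := hv β hβ hβ0
    have hd2 : d = β * (a - b) := by linear_combination β * hab + 2 * d * hβ2 + d * h3
    rw [hD2 hq3] at hC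
    refine ⟨hq3, ?_, hβ2, ?_, ?_⟩
    · rw [← hq, ← frob_apply]
      exact fun h => hw ((frob_eq_self_iff K).2 h)
    · have hZ : b ^ 2 - a ^ 2 - β * c = β * (2 * c - d * (a + b)) := by
        linear_combination β * (a + b) * hd2 + (a ^ 2 - b ^ 2) * hβ2 - β * c * h3
      rw [hZ, mul_pow, hβ2, hC, neg_neg, mul_one]
    · rw [← hd2, sub_self]
  · rintro ⟨hq3, -, hβ2, hC, hab⟩
    have h3 : (3 : F) = 0 := three_eq_zero (hq.trans hq3)
    have h2 : (2 : F) ≠ 0 := fun h => one_ne_zero (by linear_combination h3 - h : (1 : F) = 0)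
    have fixed : ∀ x : F, x ^ 2 = 1 → frob K x = x := by
      intro x hx
      rw [frob_apply, hq, hq3]
      linear_combination x * hx
    have hCeq : c - d * (a + b) / 2 = c + d * (a + b) := by
      have : (2 : F)⁻¹ = -1 := inv_eq_of_mul_eq_one_right (by linear_combination -h3)
      rw [div_eq_mul_inv, this]; ring
    have hC2 : (c + d * (a + b)) ^ 2 = 1 := by
      have hZ : b ^ 2 - a ^ 2 - β * c = -β * (c + d * (a + b)) := by
        linear_combination (a ^ 2 - b ^ 2) * hβ2 - β * (a + b) * hab
      rw [hZ] at hC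
      linear_combination hC - (c + d * (a + b)) ^ 2 * hβ2
    refine Finite.injective_iff_bijective.1 (injective_of_char_three hσ hd' h3 (hK3 hq3)
      (fixed β hβ2) hβ2 (hD2 hq3) ?_ rfl ?_ ?_)
    · linear_combination -β * hab + (a - b) * hβ2 - β * d * h3
    · rw [hCeq]; exact fixed _ hC2
    · rw [hCeq]; intro h; simp [h] at hC2

end FiniteField

/-! ### Passage to the projective line, and finiteness. -/

section RationalFunction
open Polynomial

/-- Cross-multiplying with the reduced fraction carries over both the absence of poles and the
degree inequality, so ∞ is fixed. -/
theorem onePointMap_div {F : Type*} [Field F] {p r : F[X]} (hr : ∀ x, r.eval x ≠ 0)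
    (hdeg : r.degree < p.degree) :
    (algebraMap F[X] (RatFunc F) p / algebraMap F[X] (RatFunc F) r).onePointMap =
      OnePoint.map fun x => p.eval x / r.eval x := by
  have hr0 : r ≠ 0 := by rintro rfl; exact hr 0 eval_zero
  set f := algebraMap F[X] (RatFunc F) p / algebraMap F[X] (RatFunc F) r with hf
  have hcross : f.num * r = p * f.denom := (RatFunc.num_mul_eq_mul_denom_iff hr0).2 hf
  have hden : ∀ x, f.denom.eval x ≠ 0 := by
    intro x h
    obtain ⟨g, hg⟩ := RatFunc.denom_div_dvd p r
    exact hr x (by rw [hg, eval_mul, h, zero_mul])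
  have hdeg' : f.denom.degree < f.num.degree := by
    have h := congrArg degree hcross
    rw [degree_mul, degree_mul] at h
    have hp0 : p ≠ 0 := by rintro rfl; simp at hdeg
    have hd0 : f.denom ≠ 0 := f.denom_ne_zero
    have hn0 : f.num ≠ 0 := by
      intro h0
      rw [h0, zero_mul] at hcross
      exact mul_ne_zero hp0 hd0 hcross.symm
    rw [degree_eq_natDegree hp0, degree_eq_natDegree hr0] at *
    rw [degree_eq_natDegree hd0, degree_eq_natDegree hn0] at *
    norm_cast at *
    omega
  funext y
  induction y using OnePoint.rec with
  | infty => simp [RatFunc.onePointMap, hdeg']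
  | coe x =>
    have h := congrArg (eval x) hcross
    simp only [eval_mul] at h
    have hx : f.onePointMap x = ((f.num.eval x / f.denom.eval x : F) : OnePoint F) :=
      if_neg (hden x)
    rw [OnePoint.map_some, hx, (div_eq_div_iff (hden x) (hr x)).2 h]

theorem bijective_onePoint_map {X : Type*} {g : X → X} :
    Function.Bijective (OnePoint.map g) ↔ Function.Bijective g := by
  constructor
  · rintro ⟨hi, hs⟩
    refine ⟨fun x y h => OnePoint.coe_injective (hi ?_), fun y => ?_⟩
    · rw [OnePoint.map_some, OnePoint.map_some, h]
    · obtain ⟨x, hx⟩ := hs y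
      induction x using OnePoint.rec with
      | infty => simp at hx
      | coe x => exact ⟨x, OnePoint.coe_injective (by rw [← OnePoint.map_some, hx])⟩
  · rintro ⟨hi, hs⟩
    refine ⟨fun x y h => ?_, fun y => ?_⟩
    · induction x using OnePoint.rec with
      | infty => induction y using OnePoint.rec with
        | infty => rfl
        | coe y => simp at h
      | coe x => induction y using OnePoint.rec with
        | infty => simp at h
        | coe y =>
          rw [OnePoint.map_some, OnePoint.map_some] at h
          rw [hi (OnePoint.coe_injective h)]
    · induction y using OnePoint.rec with
      | infty => exact ⟨OnePoint.infty, OnePoint.map_infty g⟩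
      | coe y =>
        obtain ⟨x, rfl⟩ := hs y
        exact ⟨x, OnePoint.map_some g x⟩

theorem isPermutation_iff {F : Type*} [Field F] {q : ℕ} (hq : 1 < q) {α β a b c d : F}
    (hα : α ≠ 0) (hden : ∀ x, x ^ q + x + d ≠ 0) :
    (secondKind q α β a b c d).IsPermutation ↔ Function.Bijective (fun x : F =>
      (α * x ^ (2 * q) + β * x ^ 2 + a * x ^ q + b * x + c) / (x ^ q + x + d)) := by
  set p : F[X] := C α * X ^ (2 * q) + C β * X ^ 2 + C a * X ^ q + C b * X + C c with hp
  set r : F[X] := X ^ q + X + C d with hr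
  have hsk : secondKind q α β a b c d =
      algebraMap F[X] (RatFunc F) p / algebraMap F[X] (RatFunc F) r := by
    simp [secondKind, hp, hr]
  have hpd : 2 * q ≤ p.natDegree := by
    refine le_natDegree_of_ne_zero ?_
    have h1 : 2 * q ≠ 2 := by omega
    have h2 : 2 * q ≠ q := by omega
    have h3 : (1 : ℕ) ≠ 2 * q := by omega
    have h4 : 2 * q ≠ 0 := by omega
    simp only [hp, coeff_add, coeff_C_mul, coeff_X_pow, coeff_X, coeff_C, h1, h2, h3, h4,
      if_true, if_false]
    simpa using hα
  have hrd : r.natDegree ≤ q := by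
    rw [hr]; compute_degree; omega
  have hp0 : p ≠ 0 := by
    rintro h; rw [h, natDegree_zero] at hpd; omega
  have hdeg : r.degree < p.degree := by
    refine degree_lt_degree (by omega)
  rw [RatFunc.IsPermutation, hsk, onePointMap_div (by simpa [hr] using hden) hdeg,
    bijective_onePoint_map]
  simp [hp, hr]

theorem isPermutation_iff_conditions {F : Type*} [Field F] [Finite F] {K : Subfield F} {q : ℕ}
    (hq : Nat.card K = q) (hK : Module.finrank K F = 2)
    {α β a b c d : F} (hd : d ∉ K) (hα : α = -β ^ q) (hα0 : α ≠ 0) :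
    (secondKind q α β a b c d).IsPermutation ↔
      (q = 3 ∧ a ^ q + b ∉ K ∧ β ^ 2 = 1 ∧ (b ^ 2 - a ^ 2 - β * c) ^ 2 = 1 ∧
        β * (a - b) - d = 0) := by
  have hden : ∀ x, x ^ q + x + d ≠ 0 := by
    intro x
    rw [← hq, ← frob_apply]
    exact denomin_ne_zero (frob_frob K hK) (fun h => hd ((frob_eq_self_iff K).1 h)) x
  rw [isPermutation_iff (hq ▸ Finite.one_lt_card) hα0 hden, bijective_iff hq hK hd hα hα0]

theorem eq_three_and_eq_one_of_pow_eq {p m : ℕ} (hp : p.Prime) (hm : 0 < m) (h : p ^ (2 * m) = 3 ^ 2) :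
    p = 3 ∧ m = 1 := by
  have hp3 : p = 3 := by
    have : p ∣ 3 ^ 2 := h ▸ dvd_pow_self p (by omega)
    exact (Nat.prime_dvd_prime_iff_eq hp Nat.prime_three).1 (hp.dvd_of_dvd_pow this)
  subst hp3
  have := Nat.pow_right_injective (by norm_num : 2 ≤ 3) h
  exact ⟨rfl, by omega⟩

end RationalFunction

end SecondKind

open SecondKind in
theorem mainTheorem5 :
    (∀ (F : Type*) [Field F] [Finite F] (K : Subfield F) (q : ℕ),
      Nat.card K = q → Module.finrank K F = 2 →
      ∀ α β a b c d : F, d ∉ K → α = -β ^ q → α ≠ 0 →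
        ((secondKind q α β a b c d).IsPermutation ↔
          (q = 3 ∧ a ^ q + b ∉ K ∧ β ^ 2 = 1 ∧ (b ^ 2 - a ^ 2 - β * c) ^ 2 = 1 ∧
            β * (a - b) - d = 0)) ∧
        (Function.Bijective (fun x : F =>
            (α * x ^ (2 * q) + β * x ^ 2 + a * x ^ q + b * x + c) / (x ^ q + x + d)) ↔
          (q = 3 ∧ a ^ q + b ∉ K ∧ β ^ 2 = 1 ∧ (b ^ 2 - a ^ 2 - β * c) ^ 2 = 1 ∧
            β * (a - b) - d = 0))) ∧
    -- over all the fields `F_{q ^ 2}` together, `q = p ^ m` ranging over all prime powers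
    {f : Σ pm : Nat.Primes × ℕ+, RatFunc (GaloisField pm.1 (2 * pm.2)) |
      ∃ (K : Subfield (GaloisField f.1.1 (2 * f.1.2)))
        (α β a b c d : GaloisField f.1.1 (2 * f.1.2)),
        Module.finrank K (GaloisField f.1.1 (2 * f.1.2)) = 2 ∧
        d ∉ K ∧ α = -β ^ Nat.card K ∧ α ≠ 0 ∧
        f.2 = secondKind (Nat.card K) α β a b c d ∧ f.2.IsPermutation}.Finite := by
  refine ⟨fun F _ _ K q hq hK α β a b c d hd hα hα0 =>
    ⟨isPermutation_iff_conditions hq hK hd hα hα0, bijective_iff hq hK hd hα hα0⟩, ?_⟩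
  let P : Nat.Primes × ℕ+ := (⟨3, Nat.prime_three⟩, 1)
  let E := GaloisField P.1 (2 * P.2)
  -- The criterion gives |K| = 3, so |F| = 9 and p = 3, m = 1: everything comes from six parameters
  -- in one finite field.
  refine (Set.finite_range fun v : E × E × E × E × E × E =>
    (⟨P, secondKind 3 v.1 v.2.1 v.2.2.1 v.2.2.2.1 v.2.2.2.2.1 v.2.2.2.2.2⟩ :
      Σ pm : Nat.Primes × ℕ+, RatFunc (GaloisField pm.1 (2 * pm.2)))).subset ?_
  rintro ⟨⟨p, m⟩, f⟩ ⟨K, α, β, a, b, c, d, hK, hd, hα, hα0, hf, hperm⟩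
  dsimp only at *
  rw [hf] at hperm
  have h3 : Nat.card K = 3 := ((isPermutation_iff_conditions rfl hK hd hα hα0).1 hperm).1
  have hcard : (p : ℕ) ^ (2 * (m : ℕ)) = 3 ^ 2 := by
    rw [← GaloisField.card p (2 * m) (by positivity), Module.natCard_eq_pow_finrank (K := K),
      h3, hK]
  obtain ⟨hp, hm⟩ := eq_three_and_eq_one_of_pow_eq p.2 m.pos hcard
  obtain rfl : p = ⟨3, Nat.prime_three⟩ := Subtype.ext hp
  obtain rfl : m = 1 := PNat.eq hm
  exact ⟨(α, β, a, b, c, d), by rw [hf, h3]⟩
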